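/- For each $n\in\mathbb N=\{1,2,\dots\}$, coupons arrive one by one at times $1,2,\dots$; their types are independent and uniformly distributed on a set of $n$ types. There are collectors labelled $r=0,1,2,\dots$, all starting with empty albums; each arriving coupon is placed in the album of the collector with the smallest label whose album does not yet contain a coupon of that type. Let $T_r^{(n)}$ be the time at which collector $r$ completes his album, i.e. first has all $n$ types; almost surely $T_r^{(n)}<\infty$ for all $r\in\mathbb N_0$. Let $B_r$, $r\in\mathbb N_0$, be independent random variables with $$\mathbb P\{B_r<x\}=\exp\Bigl(-\frac{e^{-x}}{r!}\Bigr),\qquad x\in\mathbb R.$$ Then $$\Bigl(\frac{T_r^{(n)}}{n}-\ln n-r\ln\ln n,\ r\in\mathbb N_0\Bigr)\xrightarrow{d}(B_r,\ r\in\mathbb N_0)\quad\text{in }\mathbb R^\infty\text{ as }n\to\infty,$$ where $\mathbb R^\infty=\mathbb R^{\mathbb N_0}$ carries the product topology. -/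

import Mathlib

open MeasureTheory ProbabilityTheory Filter
open scoped Nat

namespace CouponCollector

/-- `album x k r` is the set of coupon types present in the album of collector `r`
(`0` is the main collector, `1, 2, …` are the younger brothers) after the first `k` coupons
`x 0, …, x (k - 1)` have arrived. All albums are empty at time `0`. The coupon arriving at time
`k + 1` is of type `x k`; it is put into the album of the first collector, in the order
`0, 1, 2, …`, who does not yet have this type, and no other album changes. -/
def album {n : ℕ} (x : ℕ → Fin n) : ℕ → ℕ → Set (Fin n)
  | 0, _ => ∅
  | k + 1, r =>
      album x k r ∪ {i | i = x k ∧ i ∉ album x k r ∧ ∀ s, s < r → i ∈ album x k s}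

/-- The time at which collector `r` completes his album: the least `k` such that all `n` types
are in his album after `k` arrivals. The value is the junk value `0` if the album is never
completed. -/
noncomputable def completionTime {n : ℕ} (x : ℕ → Fin n) (r : ℕ) : ℕ :=
  sInf {k : ℕ | album x k r = Set.univ}

/-- The sequence of the centred and normalised completion times of all collectors,
`T_r / n - ln n - r ln ln n` for `r = 0, 1, 2, …`, as a point of `ℕ → ℝ`. -/
noncomputable def normalizedTimes {n : ℕ} (x : ℕ → Fin n) : ℕ → ℝ := fun r =>
  (completionTime x r : ℝ) / (n : ℝ) - Real.log (n : ℝ)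
    - (r : ℝ) * Real.log (Real.log (n : ℝ))

end CouponCollector

/-! Collector `r` receives exactly the `(r+1)`-st copy of each type, so `T_r ≤ k` means that every
type occurs more than `r` times among the first `k` coupons. The joint distribution functions thus
concern type counts only (`mem_album_iff`, `completionTime_le_iff`).

Now Poissonize: observe the coupons at the arrival counts of a Poisson process of rate `n`, at times
`t_r = ln n + r ln ln n + x_r`. The count processes of the `n` types become independent
(`map_blockCount_eq`), so the probability is `p ^ n`, with `p` the chance that a unit-rate process
`N` has `N(t_r) > r` for all `r ∈ S`. Each failure has `n P(N(t_r) ≤ r) → e^{-x_r}/r!`. The gaps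
`t_{r+1} - t_r` grow like `ln ln n`, so after one failure the process almost surely catches up
before the next time: failures are asymptotically disjoint, `n (1 - p)` tends to the sum of these
limits, and `p ^ n` to the product of Gumbel factors (`tendsto_poissonPi_pow`). This is where
asymptotic independence comes from.

By Chebyshev the Poisson clock deviates by `n ε` with vanishing probability, so moving `x` by `±ε`
sandwiches the original probability, and the limit is continuous in `ε`
(`tendsto_measureReal_collectedEvent`). Distribution functions over finite sets of coordinates then
determine weak convergence in the product space (`tendsto_probabilityMeasure_of_tendsto_cdf`). -/

open scoped Topology NNReal ENNReal

namespace CouponCollector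

/-! ### Albums in terms of type counts. -/

/-- The number of coupons of type `i` among the first `k` coupons. -/
def couponCount {n : ℕ} (x : ℕ → Fin n) (k : ℕ) (i : Fin n) : ℕ :=
  ((Finset.range k).filter (fun j => x j = i)).card

lemma couponCount_succ {n : ℕ} (x : ℕ → Fin n) (k : ℕ) (i : Fin n) :
    couponCount x (k + 1) i = couponCount x k i + if x k = i then 1 else 0 := by
  unfold couponCount
  rw [Finset.range_add_one, Finset.filter_insert]
  split_ifs <;> simp

lemma couponCount_mono {n : ℕ} (x : ℕ → Fin n) (i : Fin n) :
    Monotone (fun k => couponCount x k i) :=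
  monotone_nat_of_le_succ fun k => by simp [couponCount_succ]

/-- By induction the albums holding a type form an initial segment whose length is its count, so a
new copy goes to the collector whose label equals the current count. -/
lemma mem_album_iff {n : ℕ} (x : ℕ → Fin n) (k r : ℕ) (i : Fin n) :
    i ∈ album x k r ↔ r < couponCount x k i := by
  induction k generalizing r with
  | zero => simp [album, couponCount]
  | succ k ih =>
    simp only [album, Set.mem_union, Set.mem_ofPred_eq, ih, couponCount_succ, not_lt]
    constructor
    · rintro (h | ⟨rfl, h1, h2⟩)
      · omega
      · have : r ≤ couponCount x k (x k) := by
          by_contra! hlt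
          exact lt_irrefl _ (h2 _ hlt)
        simp
        omega
    · intro h
      by_cases hr : r < couponCount x k i
      · exact Or.inl hr
      · right
        split_ifs at h with hi
        · exact ⟨hi.symm, by omega, fun s hs => by omega⟩
        · omega

lemma album_eq_univ_iff {n : ℕ} (x : ℕ → Fin n) (k r : ℕ) :
    album x k r = Set.univ ↔ ∀ i, r < couponCount x k i := by
  simp [Set.eq_univ_iff_forall, mem_album_iff]

lemma completionTime_le_iff {n : ℕ} {x : ℕ → Fin n} {r : ℕ}
    (h : ∃ k, album x k r = Set.univ) (k : ℕ) :
    completionTime x r ≤ k ↔ ∀ i, r < couponCount x k i := by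
  rw [← album_eq_univ_iff]
  have hmem : album x (completionTime x r) r = Set.univ := Nat.sInf_mem h
  constructor
  · intro hk
    rw [album_eq_univ_iff] at hmem ⊢
    exact fun i => (hmem i).trans_le (couponCount_mono x i hk)
  · exact fun hk => Nat.sInf_le hk

/-! ### Measurability and almost sure completion. -/

section Measurability

variable {Ω : Type*} [MeasurableSpace Ω] {n : ℕ} {X : ℕ → Ω → Fin n}

lemma measurable_couponCount (hX : ∀ k, Measurable (X k)) (k : ℕ) (i : Fin n) :
    Measurable (fun ω => couponCount (fun j => X j ω) k i) := by
  induction k with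
  | zero => simp [couponCount]
  | succ k ih =>
    simp only [couponCount_succ]
    exact ih.add (Measurable.ite (measurableSet_eq_fun (hX k) measurable_const)
      measurable_const measurable_const)

lemma measurableSet_forall_lt_couponCount (hX : ∀ k, Measurable (X k)) (k r : ℕ) :
    MeasurableSet {ω | ∀ i, r < couponCount (fun j => X j ω) k i} := by
  rw [Set.ofPred_forall]
  exact MeasurableSet.iInter fun i =>
    measurableSet_lt measurable_const (measurable_couponCount hX k i)

lemma measurable_completionTime (hX : ∀ k, Measurable (X k)) (r : ℕ) :
    Measurable (fun ω => completionTime (fun j => X j ω) r) := by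
  refine measurable_of_Iic fun k => ?_
  -- The second set collects the outcomes where the album is never completed; the junk value `0`
  -- puts them in every `Iic k`.
  have : (fun ω => completionTime (fun j => X j ω) r) ⁻¹' Set.Iic k =
      {ω | ∀ i, r < couponCount (fun j => X j ω) k i} ∪
        ⋂ m, {ω | ∀ i, r < couponCount (fun j => X j ω) m i}ᶜ := by
    ext ω
    simp only [Set.mem_preimage, Set.mem_Iic, Set.mem_union, Set.mem_iInter, Set.mem_compl_iff]
    by_cases h : ∃ k, album (fun j => X j ω) k r = Set.univ
    · rw [completionTime_le_iff h]
      simp only [album_eq_univ_iff] at h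
      obtain ⟨m, hm⟩ := h
      exact ⟨Or.inl, fun h => h.elim id fun h => absurd hm (h m)⟩
    · have h0 : completionTime (fun j => X j ω) r = 0 := by
        rw [completionTime, Nat.sInf_eq_zero]
        exact Or.inr (Set.eq_empty_of_forall_notMem fun k hk => h ⟨k, hk⟩)
      simp only [h0, zero_le, true_iff]
      right
      intro m hm
      exact h ⟨m, (album_eq_univ_iff _ _ _).2 hm⟩
  rw [this]
  exact (measurableSet_forall_lt_couponCount hX k r).union
    (MeasurableSet.iInter fun m => (measurableSet_forall_lt_couponCount hX m r).compl)

lemma measurable_normalizedTimes (hX : ∀ k, Measurable (X k)) :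
    Measurable (fun ω => normalizedTimes (fun j => X j ω)) := by
  refine measurable_pi_lambda _ fun r => ?_
  unfold normalizedTimes
  have := measurable_completionTime hX r
  exact ((((measurable_from_top (f := fun k : ℕ => (k : ℝ))).comp this).div_const _).sub_const
    _).sub_const _

/-- Almost surely every type of coupon arrives arbitrarily often. -/
lemma ae_exists_album_eq_univ {μ : Measure Ω} [IsProbabilityMeasure μ]
    (hX : ∀ k, Measurable (X k)) (hindep : iIndepFun X μ)
    (hunif : ∀ k i, μ.real {ω | X k ω = i} = 1 / (n : ℝ)) :
    ∀ᵐ ω ∂μ, ∀ r : ℕ, ∃ k : ℕ, album (fun j => X j ω) k r = Set.univ := by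
  have hio : ∀ i : Fin n, ∀ᵐ ω ∂μ, ∃ᶠ k in atTop, X k ω = i := by
    intro i
    have hn : 0 < n := i.pos
    have hmeas : ∀ k, MeasurableSet (X k ⁻¹' {i}) := fun k => hX k (measurableSet_singleton i)
    have h1 : μ (limsup (fun k => X k ⁻¹' {i}) atTop) = 1 := by
      -- Second Borel–Cantelli lemma: independent events of constant positive probability.
      refine measure_limsup_eq_one hmeas ?_ ?_
      · rw [iIndepSet_iff_meas_biInter hmeas]
        intro T
        exact hindep.measure_inter_preimage_eq_mul T fun k _ => measurableSet_singleton i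
      · have : ∀ k, μ (X k ⁻¹' {i}) = ENNReal.ofReal (1 / n) := by
          intro k
          rw [← hunif k i, ofReal_measureReal]
          rfl
        simp_rw [this]
        refine ENNReal.tsum_const_eq_top_of_ne_zero ?_
        simpa using hn.ne'
    have h2 := (prob_compl_eq_zero_iff (MeasurableSet.measurableSet_limsup hmeas)).2 h1
    filter_upwards [measure_eq_zero_iff_ae_notMem.1 h2] with ω hω
    have := not_not.1 hω
    rwa [mem_limsup_iff_frequently_mem] at this
  filter_upwards [ae_all_iff.2 hio] with ω hω r
  simp only [album_eq_univ_iff]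
  have hub : ∀ i, ∃ k, r < couponCount (fun j => X j ω) k i := by
    intro i
    induction r with
    | zero =>
      obtain ⟨k, hk⟩ := (hω i).exists
      exact ⟨k + 1, by simp [couponCount_succ, hk]⟩
    | succ r ih =>
      obtain ⟨k, hk⟩ := ih
      obtain ⟨m, hm, hmi⟩ := (frequently_atTop.1 (hω i)) k
      refine ⟨m + 1, ?_⟩
      have := couponCount_mono (fun j => X j ω) i hm
      simp only [couponCount_succ, hmi, if_true] at this ⊢
      omega
  choose k hk using hub
  exact ⟨Finset.univ.sup k, fun i =>
    (hk i).trans_le (couponCount_mono _ i (Finset.le_sup (Finset.mem_univ i)))⟩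

end Measurability

/-! ### Weak convergence from finite-dimensional distribution functions. -/

section WeakConvergence

variable {κ : Type*} {ι : Type*} {l : Filter ι}

lemma measurableSet_forall_mem_le (S : Finset κ) (b : κ → ℝ) :
    MeasurableSet {y : κ → ℝ | ∀ r ∈ S, y r ≤ b r} := by
  simp only [Set.ofPred_forall]
  exact S.measurableSet_biInter fun r _ => measurableSet_le (measurable_pi_apply r) measurable_const

lemma measurableSet_forall_mem_lt (S : Finset κ) (a : κ → ℝ) :
    MeasurableSet {y : κ → ℝ | ∀ r ∈ S, a r < y r} := by
  simp only [Set.ofPred_forall]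
  exact S.measurableSet_biInter fun r _ => measurableSet_lt measurable_const (measurable_pi_apply r)

/-- Inclusion–exclusion, one lower bound at a time: imposing `a q < y q` subtracts the box with the
additional upper bound `y q ≤ a q`. -/
lemma tendsto_measureReal_box {μ : ι → Measure (κ → ℝ)} [∀ i, IsFiniteMeasure (μ i)]
    {ν : Measure (κ → ℝ)} [IsFiniteMeasure ν]
    (h : ∀ (S : Finset κ) (b : κ → ℝ), Tendsto (fun i => (μ i).real {y | ∀ r ∈ S, y r ≤ b r}) l
      (𝓝 (ν.real {y | ∀ r ∈ S, y r ≤ b r})))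
    (R S : Finset κ) (a b : κ → ℝ) :
    Tendsto (fun i => (μ i).real ({y | ∀ r ∈ S, y r ≤ b r} ∩ {y | ∀ r ∈ R, a r < y r})) l
      (𝓝 (ν.real ({y | ∀ r ∈ S, y r ≤ b r} ∩ {y | ∀ r ∈ R, a r < y r}))) := by
  classical
  induction R using Finset.induction_on generalizing S b with
  | empty => simpa using h S b
  | insert q R hq ih =>
    let b' : κ → ℝ := fun r => if r = q then (if q ∈ S then min (a q) (b q) else a q) else b r
    have key : ∀ (m : Measure (κ → ℝ)) [IsFiniteMeasure m],
        m.real ({y | ∀ r ∈ S, y r ≤ b r} ∩ {y | ∀ r ∈ insert q R, a r < y r}) =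
          m.real ({y | ∀ r ∈ S, y r ≤ b r} ∩ {y | ∀ r ∈ R, a r < y r}) -
          m.real ({y | ∀ r ∈ insert q S, y r ≤ b' r} ∩ {y | ∀ r ∈ R, a r < y r}) := by
      intro m _
      have hb' : ∀ y : κ → ℝ, (∀ r ∈ insert q S, y r ≤ b' r) ↔
          (∀ r ∈ S, y r ≤ b r) ∧ y q ≤ a q := by
        intro y
        simp only [Finset.forall_mem_insert, b', if_true]
        constructor
        · rintro ⟨h1, h2⟩
          refine ⟨fun r hr => ?_, ?_⟩
          · have := h2 r hr
            split_ifs at this h1 with h3 h4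
            · subst h3; exact this.trans (min_le_right _ _)
            · subst h3; exact absurd hr h4
            · exact this
            · exact this
          · split_ifs at h1
            · exact h1.trans (min_le_left _ _)
            · exact h1
        · rintro ⟨h1, h2⟩
          refine ⟨?_, fun r hr => ?_⟩
          · split_ifs with h3
            · exact le_min h2 (h1 q h3)
            · exact h2
          · split_ifs with h3 h4
            · subst h3; exact le_min h2 (h1 _ hr)
            · subst h3; exact h2
            · exact h1 r hr
      have hset : {y : κ → ℝ | ∀ r ∈ insert q S, y r ≤ b' r} =
          {y | (∀ r ∈ S, y r ≤ b r) ∧ y q ≤ a q} := Set.ext hb'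
      rw [← measureReal_sdiff]
      · rw [hset]
        congr 1
        ext y
        simp only [Set.mem_inter_iff, Set.mem_ofPred_eq, Set.mem_sdiff, Finset.forall_mem_insert]
        constructor
        · rintro ⟨h1, h2, h3⟩
          exact ⟨⟨h1, h3⟩, fun h4 => absurd h4.1.2 (not_le.2 h2)⟩
        · rintro ⟨⟨h1, h3⟩, h4⟩
          exact ⟨h1, not_le.1 fun h5 => h4 ⟨⟨h1, h5⟩, h3⟩, h3⟩
      · intro y hy
        exact ⟨((hb' y).1 hy.1).1, hy.2⟩
      · exact (measurableSet_forall_mem_le _ _).inter (measurableSet_forall_mem_lt _ _)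
    simp_rw [key]
    exact (ih S b).sub (ih (insert q S) b')

/-- Probability measures on a countable power of the real line converge weakly when their
finite-dimensional distribution functions converge pointwise. -/
theorem tendsto_probabilityMeasure_of_tendsto_cdf [Countable κ] [l.IsCountablyGenerated]
    {μ : ι → ProbabilityMeasure (κ → ℝ)} {ν : ProbabilityMeasure (κ → ℝ)}
    (h : ∀ (S : Finset κ) (b : κ → ℝ),
      Tendsto (fun i => (μ i : Measure (κ → ℝ)).real {y | ∀ r ∈ S, y r ≤ b r}) l
      (𝓝 ((ν : Measure (κ → ℝ)).real {y | ∀ r ∈ S, y r ≤ b r}))) :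
    Tendsto μ l (𝓝 ν) := by
  classical
  -- Half-open boxes in finitely many coordinates form a π-system containing small neighbourhoods of
  -- every point, so convergence on them suffices.
  let 𝒮 : Set (Set (κ → ℝ)) := {B | ∃ (S R : Finset κ) (a b : κ → ℝ),
    B = {y | ∀ r ∈ S, y r ≤ b r} ∩ {y | ∀ r ∈ R, a r < y r}}
  have hpi : IsPiSystem 𝒮 := by
    rintro _ ⟨S, R, a, b, rfl⟩ _ ⟨S', R', a', b', rfl⟩ -
    refine ⟨S ∪ S', R ∪ R',
      fun r => if r ∈ R then (if r ∈ R' then max (a r) (a' r) else a r) else a' r,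
      fun r => if r ∈ S then (if r ∈ S' then min (b r) (b' r) else b r) else b' r, ?_⟩
    ext y
    simp only [Set.mem_inter_iff, Set.mem_ofPred_eq, Finset.mem_union]
    constructor
    · rintro ⟨⟨h1, h2⟩, h3, h4⟩
      refine ⟨fun r hr => ?_, fun r hr => ?_⟩
      · split_ifs <;> grind
      · split_ifs <;> grind
    · rintro ⟨h1, h2⟩
      refine ⟨⟨fun r hr => ?_, fun r hr => ?_⟩, fun r hr => ?_, fun r hr => ?_⟩
      · have := h1 r (Or.inl hr); grind
      · have := h2 r (Or.inl hr); grind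
      · have := h1 r (Or.inr hr); grind
      · have := h2 r (Or.inr hr); grind
  refine hpi.tendsto_probabilityMeasure_of_tendsto_of_mem ?_ ?_ ?_
  · rintro _ ⟨S, R, a, b, rfl⟩
    exact (measurableSet_forall_mem_le _ _).inter (measurableSet_forall_mem_lt _ _)
  · intro u hu x hx
    obtain ⟨S, t, ht, hsub⟩ := isOpen_pi_iff.1 hu x hx
    have hε : ∀ r, ∃ ε > 0, r ∈ S → Set.Icc (x r - ε) (x r + ε) ⊆ t r := by
      intro r
      by_cases hr : r ∈ S
      · obtain ⟨ε, hε, hball⟩ := Metric.nhds_basis_closedBall.mem_iff.1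
          ((ht r hr).1.mem_nhds (ht r hr).2)
        exact ⟨ε, hε, fun _ => by rwa [← Real.closedBall_eq_Icc]⟩
      · exact ⟨1, one_pos, fun h => absurd h hr⟩
    choose ε hε0 hε using hε
    refine ⟨_, ⟨S, S, fun r => x r - ε r, fun r => x r + ε r, rfl⟩, ?_, ?_⟩
    · have : (S : Set κ).pi (fun r => Set.Ioo (x r - ε r) (x r + ε r)) ∈ 𝓝 x :=
        set_pi_mem_nhds S.finite_toSet fun r _ =>
          Ioo_mem_nhds (by linarith [hε0 r]) (by linarith [hε0 r])
      refine mem_of_superset this fun y hy => ⟨fun r hr => (hy r hr).2.le, fun r hr => (hy r hr).1⟩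
    · rintro y ⟨h1, h2⟩
      exact hsub fun r hr => hε r hr ⟨(h2 r hr).le, h1 r hr⟩
  · rintro _ ⟨S, R, a, b, rfl⟩
    rw [← NNReal.tendsto_coe]
    exact tendsto_measureReal_box (μ := fun i => (μ i : Measure (κ → ℝ))) (ν := ν) h R S a b

end WeakConvergence

/-! ### Multinomial law for labelled coupons. -/

section Multinomial

variable {κ : Type*} [DecidableEq κ] {n : ℕ}

/-- The number of `j ∈ J` with label `s`. -/
def labelSize (σ : ℕ → κ) (J : Finset ℕ) (s : κ) : ℕ :=
  ∑ j ∈ J, if σ j = s then 1 else 0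

/-- The number of coupons in `J` with a given type and a given label. -/
def labelCount (x : ℕ → Fin n) (σ : ℕ → κ) (J : Finset ℕ) (p : Fin n × κ) : ℕ :=
  ∑ j ∈ J, if (x j, σ j) = p then 1 else 0

lemma labelSize_insert (σ : ℕ → κ) {J : Finset ℕ} {j : ℕ} (hj : j ∉ J) :
    labelSize σ (insert j J) = labelSize σ J + Pi.single (σ j) 1 := by
  ext s
  simp [labelSize, Finset.sum_insert hj, Pi.single_apply, eq_comm, add_comm]

lemma labelCount_insert (x : ℕ → Fin n) (σ : ℕ → κ) {J : Finset ℕ} {j : ℕ} (hj : j ∉ J) :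
    labelCount x σ (insert j J) = labelCount x σ J + Pi.single (x j, σ j) 1 := by
  ext s
  simp only [labelCount, Finset.sum_insert hj, Pi.add_apply, Pi.single_apply]
  rw [add_comm]
  congr 1
  simp only [eq_comm]

lemma prod_factorial_add_single {α : Type*} [Fintype α] [DecidableEq α] (y : α → ℕ) (a : α) :
    ∏ p, ((y + Pi.single a 1 : α → ℕ) p)! = (y a + 1) * ∏ p, (y p)! := by
  rw [← Finset.mul_prod_erase _ _ (Finset.mem_univ a),
    ← Finset.mul_prod_erase Finset.univ (fun p => (y p)!) (Finset.mem_univ a), ← mul_assoc]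
  congr 1
  · simp [Nat.factorial_succ]
  · refine Finset.prod_congr rfl fun p hp => ?_
    simp [Finset.ne_of_mem_erase hp]

variable {Ω : Type*} [MeasurableSpace Ω] {μ : Measure Ω} {X : ℕ → Ω → Fin n}

lemma measurable_labelCount [Countable κ] (hX : ∀ k, Measurable (X k)) (σ : ℕ → κ)
    (J : Finset ℕ) : Measurable (fun ω => labelCount (fun j => X j ω) σ J) := by
  refine measurable_pi_lambda _ fun p => ?_
  refine Finset.measurable_sum _ fun j _ => ?_
  exact (measurable_from_top (f := fun i : Fin n => if (i, σ j) = p then 1 else 0)).comp (hX j)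

lemma indepFun_labelCount (hX : ∀ k, Measurable (X k)) (hindep : iIndepFun X μ)
    (σ : ℕ → κ) {J : Finset ℕ} {j : ℕ} (hj : j ∉ J) :
    IndepFun (X j) (fun ω => labelCount (fun k => X k ω) σ J) μ := by
  have h := hindep.indepFun_finset {j} J (by simpa using hj) hX
  have h2 := h.comp (measurable_pi_apply ⟨j, by simp⟩)
    (measurable_of_countable (fun (z : J → Fin n) (p : Fin n × κ) =>
      ∑ k : J, if (z k, σ k) = p then 1 else 0))
  have he : (fun ω => labelCount (fun k => X k ω) σ J) =
      (fun (z : J → Fin n) (p : Fin n × κ) => ∑ k : J, if (z k, σ k) = p then 1 else 0) ∘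
        (fun ω (k : J) => X k ω) := by
    ext ω p
    exact (Finset.sum_coe_sort J (fun k => if (X k ω, σ k) = p then 1 else 0)).symm
  rw [he]
  exact h2

variable [Fintype κ] [IsProbabilityMeasure μ]

/-- The multinomial law, for coupons that carry deterministic labels. -/
lemma measureReal_labelCount_eq (hX : ∀ k, Measurable (X k)) (hindep : iIndepFun X μ)
    (hunif : ∀ k i, μ.real {ω | X k ω = i} = 1 / (n : ℝ)) (hn : n ≠ 0) (σ : ℕ → κ)
    (J : Finset ℕ) (y : Fin n × κ → ℕ) (hy : ∀ s, ∑ i, y (i, s) = labelSize σ J s) :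
    μ.real {ω | labelCount (fun j => X j ω) σ J = y} =
      (∏ s, (labelSize σ J s)! : ℕ) / ((n : ℝ) ^ J.card * (∏ p, (y p)! : ℕ)) := by
  induction J using Finset.induction_on generalizing y with
  | empty =>
    have h0 : y = 0 := by
      ext ⟨i, s⟩
      have := hy s
      simp only [labelSize, Finset.sum_empty, Finset.sum_eq_zero_iff] at this
      simpa using this i
    subst h0
    have : ∀ ω, labelCount (fun j => X j ω) σ ∅ = 0 := fun ω => by ext; simp [labelCount]
    simp [this, labelSize]
  | insert j J hj ih =>
    have hne : (n : ℝ) ≠ 0 := by exact_mod_cast hn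
    -- Split by the type `i` of the new coupon. Each term is proportional to `y (i, σ j)`, and these
    -- sum to the new label size, the factor by which the numerator's factorial grows.
    have hterm : ∀ i : Fin n,
        μ.real (X j ⁻¹' {i} ∩ (fun ω => labelCount (fun k => X k ω) σ J) ⁻¹'
          {v | v + Pi.single (i, σ j) 1 = y}) =
        (y (i, σ j) : ℝ) * ((∏ s, (labelSize σ J s)! : ℕ) /
          ((n : ℝ) ^ (J.card + 1) * (∏ p, (y p)! : ℕ))) := by
      intro i
      by_cases h0 : y (i, σ j) = 0
      · have : {v : Fin n × κ → ℕ | v + Pi.single (i, σ j) 1 = y} = ∅ := by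
          refine Set.eq_empty_of_forall_notMem fun v hv => ?_
          have := congrFun hv (i, σ j)
          simp [h0] at this
        simp [this, h0]
      · obtain ⟨y', rfl⟩ : ∃ y', y = y' + Pi.single (i, σ j) 1 := by
          refine ⟨y - Pi.single (i, σ j) 1, (tsub_add_cancel_of_le fun p => ?_).symm⟩
          by_cases hp : p = (i, σ j)
          · subst hp; simp; omega
          · simp [hp]
        have hset : {v : Fin n × κ → ℕ | v + Pi.single (i, σ j) 1 = y' + Pi.single (i, σ j) 1}
            = {y'} := by
          ext v; simp
        have hy' : ∀ s, ∑ i, y' (i, s) = labelSize σ J s := by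
          intro s
          have := hy s
          rw [labelSize_insert σ hj] at this
          simp only [Pi.add_apply, Finset.sum_add_distrib] at this
          have h3 : ∑ x : Fin n, (Pi.single (i, σ j) 1 : Fin n × κ → ℕ) (x, s) =
              (Pi.single (σ j) 1 : κ → ℕ) s := by
            simp only [Pi.single_apply, Prod.mk.injEq]
            by_cases hs : s = σ j <;> simp [hs]
          omega
        rw [hset, measureReal_def, (indepFun_labelCount hX hindep σ hj).measure_inter_preimage_eq_mul
          _ _ (measurableSet_singleton i) (measurableSet_singleton y'), ENNReal.toReal_mul,
          ← measureReal_def, ← measureReal_def]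
        have e1 : μ.real (X j ⁻¹' {i}) = 1 / n := hunif j i
        have e2 := ih y' hy'
        have e3 : μ.real ((fun ω => labelCount (fun k => X k ω) σ J) ⁻¹' {y'}) = _ := e2
        rw [e1, e3, prod_factorial_add_single]
        have hp : ((∏ p, (y' p)! : ℕ) : ℝ) ≠ 0 := by
          exact_mod_cast Finset.prod_ne_zero_iff.2 fun p _ => Nat.factorial_ne_zero _
        have hq : ((y' (i, σ j) + 1 : ℕ) : ℝ) ≠ 0 := by positivity
        simp only [Pi.add_apply, Pi.single_eq_same]
        rw [Nat.cast_mul (y' (i, σ j) + 1)]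
        generalize ((∏ p, (y' p)! : ℕ) : ℝ) = A at *
        generalize ((y' (i, σ j) + 1 : ℕ) : ℝ) = B at *
        rw [pow_succ']
        field_simp
    have hunion : {ω | labelCount (fun k => X k ω) σ (insert j J) = y} =
        ⋃ i ∈ (Finset.univ : Finset (Fin n)), (X j ⁻¹' {i} ∩
          (fun ω => labelCount (fun k => X k ω) σ J) ⁻¹' {v | v + Pi.single (i, σ j) 1 = y}) := by
      ext ω
      simp [labelCount_insert _ σ hj]
    rw [hunion, measureReal_biUnion_finset]
    · simp_rw [hterm]
      rw [← Finset.sum_mul, Finset.card_insert_of_notMem hj, labelSize_insert σ hj,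
        prod_factorial_add_single, ← Nat.cast_sum, hy, labelSize_insert σ hj]
      simp only [Pi.add_apply, Pi.single_eq_same, Nat.cast_mul]
      ring
    · intro i _ i' _ hii'
      refine Set.disjoint_left.2 fun ω h1 h2 => hii' ?_
      rw [← show X j ω = i from h1.1, ← show X j ω = i' from h2.1]
    · intro i _
      exact (hX j (measurableSet_singleton i)).inter
        (measurable_labelCount hX σ J (Set.to_countable _).measurableSet)

end Multinomial

/-! ### Partial sums of finite families. -/

section PartialSum

variable {R : Type*} [AddCommMonoid R] {M : ℕ}

/-- The sum of the first `k` entries of a finite family. -/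
def partialSum (z : Fin M → R) (k : ℕ) : R :=
  ∑ u ∈ Finset.univ.filter (fun u : Fin M => u.val < k), z u

lemma partialSum_zero (z : Fin M → R) : partialSum z 0 = 0 := by simp [partialSum]

lemma partialSum_succ (z : Fin M → R) (s : Fin M) :
    partialSum z (s + 1) = partialSum z s + z s := by
  unfold partialSum
  have : Finset.univ.filter (fun u : Fin M => u.val < s + 1) =
      insert s (Finset.univ.filter (fun u : Fin M => u.val < s)) := by
    ext u; simp [Fin.ext_iff]; omega
  rw [this, Finset.sum_insert (by simp), add_comm]

lemma partialSum_succ_of_le (z : Fin M → R) {k : ℕ} (hk : M ≤ k) :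
    partialSum z (k + 1) = partialSum z k := by
  unfold partialSum
  congr 1
  ext u
  have := u.2
  simp; omega

lemma partialSum_mono (z : Fin M → ℕ) : Monotone (partialSum z) := fun a b hab =>
  Finset.sum_le_sum_of_subset fun u hu => by
    simp only [Finset.mem_filter, Finset.mem_univ, true_and] at hu ⊢
    omega

end PartialSum

/-! ### Blocks of coupons and Poisson splitting. -/

section Blocks

variable {M n : ℕ}

/-- The `s`-th of the successive blocks of coupons with lengths `d 0, d 1, …`. -/
def block (d : Fin M → ℕ) (s : Fin M) : Finset ℕ :=
  Finset.Ico (partialSum d s) (partialSum d (s + 1))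

/-- The number of coupons of type `i` in the `s`-th block. -/
def blockCount (x : ℕ → Fin n) (d : Fin M → ℕ) (i : Fin n) (s : Fin M) : ℕ :=
  ((block d s).filter (fun j => x j = i)).card

lemma card_block (d : Fin M → ℕ) (s : Fin M) : (block d s).card = d s := by
  simp [block, partialSum_succ]

lemma sum_blockCount (x : ℕ → Fin n) (d : Fin M → ℕ) (s : Fin M) :
    ∑ i, blockCount x d i s = d s := by
  rw [← card_block d s]
  exact (Finset.card_eq_sum_card_fiberwise fun j _ => Finset.mem_univ (x j)).symm

lemma partialSum_blockCount (x : ℕ → Fin n) (d : Fin M → ℕ) (i : Fin n) (k : ℕ) :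
    partialSum (blockCount x d i) k = couponCount x (partialSum d k) i := by
  induction k with
  | zero => simp [partialSum_zero, couponCount]
  | succ k ih =>
    by_cases hk : k < M
    · have h := partialSum_succ (blockCount x d i) ⟨k, hk⟩
      simp only at h
      rw [h, ih]
      have hle : partialSum d k ≤ partialSum d (k + 1) := partialSum_mono d k.le_succ
      unfold couponCount blockCount block
      rw [← Finset.card_union_of_disjoint, ← Finset.filter_union]
      · congr 2
        ext j
        simp only [Finset.mem_union, Finset.mem_range, Finset.mem_Ico]
        omega
      · refine Finset.disjoint_filter_filter ?_
        rw [Finset.disjoint_left]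
        intro j
        simp only [Finset.mem_range, Finset.mem_Ico]
        omega
    · rw [partialSum_succ_of_le _ (not_lt.1 hk), partialSum_succ_of_le _ (not_lt.1 hk), ih]

lemma block_disjoint (d : Fin M → ℕ) {s t : Fin M} {j : ℕ} (hs : j ∈ block d s)
    (ht : j ∈ block d t) : s = t := by
  simp only [block, Finset.mem_Ico] at hs ht
  rcases lt_trichotomy s t with h | h | h
  · have := partialSum_mono d (show (s : ℕ) + 1 ≤ t from h)
    omega
  · exact h
  · have := partialSum_mono d (show (t : ℕ) + 1 ≤ s from h)
    omega

variable {Ω : Type*} [MeasurableSpace Ω] {μ : Measure Ω} [IsProbabilityMeasure μ]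
  {X : ℕ → Ω → Fin n}

lemma measureReal_blockCount_eq (hX : ∀ k, Measurable (X k)) (hindep : iIndepFun X μ)
    (hunif : ∀ k i, μ.real {ω | X k ω = i} = 1 / (n : ℝ)) (hn : n ≠ 0) [NeZero M]
    (d : Fin M → ℕ) (y : Fin n → Fin M → ℕ) (hy : ∀ s, ∑ i, y i s = d s) :
    μ.real {ω | blockCount (fun j => X j ω) d = y} =
      ∏ s, (((d s)! : ℝ) / ((n : ℝ) ^ d s * ∏ i, ((y i s)! : ℝ))) := by
  classical
  obtain ⟨σ, hσ⟩ : ∃ σ : ℕ → Fin M, ∀ s, ∀ j ∈ block d s, σ j = s := by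
    -- Label each position by its block, unique by disjointness; positions outside all blocks get an
    -- irrelevant label.
    refine ⟨fun j => if h : ∃ s, j ∈ block d s then h.choose else 0, fun s j hj => ?_⟩
    have h : ∃ s, j ∈ block d s := ⟨s, hj⟩
    simp only [h, dif_pos]
    exact block_disjoint d h.choose_spec hj
  let J : Finset ℕ := Finset.univ.biUnion (block d)
  have hJ : ∀ s, J.filter (fun j => σ j = s) = block d s := by
    intro s
    ext j
    simp only [J, Finset.mem_filter, Finset.mem_biUnion, Finset.mem_univ, true_and]
    constructor
    · rintro ⟨⟨t, ht⟩, hjs⟩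
      rwa [← hjs, hσ t j ht]
    · exact fun hj => ⟨⟨s, hj⟩, hσ s j hj⟩
  have hsize : ∀ s, labelSize σ J s = d s := by
    intro s
    rw [labelSize, ← Finset.card_filter, hJ, card_block]
  have hcount : ∀ x : ℕ → Fin n, ∀ p, labelCount x σ J p = blockCount x d p.1 p.2 := by
    rintro x ⟨i, s⟩
    rw [labelCount, ← Finset.card_filter, blockCount, ← hJ, Finset.filter_filter]
    congr 1
    ext j
    simp [and_comm]
  have hcard : J.card = ∑ s, d s := by
    rw [Finset.card_biUnion]
    · exact Finset.sum_congr rfl fun s _ => card_block d s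
    · intro s _ t _ hst
      exact Finset.disjoint_left.2 fun j hs ht => hst (block_disjoint d hs ht)
  have h := measureReal_labelCount_eq hX hindep hunif hn σ J (fun p => y p.1 p.2)
    (fun s => by rw [hsize]; exact hy s)
  have hset : {ω | labelCount (fun j => X j ω) σ J = fun p => y p.1 p.2} =
      {ω | blockCount (fun j => X j ω) d = y} := by
    ext ω
    simp only [Set.mem_ofPred_eq, funext_iff, hcount, Prod.forall]
  rw [hset, hcard] at h
  rw [h]
  simp_rw [hsize]
  rw [Finset.prod_div_distrib, Finset.prod_mul_distrib, Finset.prod_pow_eq_pow_sum,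
    Fintype.prod_prod_type_right]
  push_cast
  rfl

lemma measurable_blockCount (hX : ∀ k, Measurable (X k)) :
    Measurable (fun q : Ω × (Fin M → ℕ) => blockCount (fun j => X j q.1) q.2) := by
  refine measurable_from_prod_countable_left fun d => ?_
  refine measurable_pi_lambda _ fun i => measurable_pi_lambda _ fun s => ?_
  simp only [blockCount, Finset.card_filter]
  refine Finset.measurable_sum _ fun j _ => ?_
  exact (measurable_from_top (f := fun i' : Fin n => if i' = i then 1 else 0)).comp (hX j)

/-- The law of a family of independent Poisson variables. -/
noncomputable def poissonPi (a : Fin M → ℝ≥0) : Measure (Fin M → ℕ) :=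
  Measure.pi fun s => poissonMeasure (a s)

instance (a : Fin M → ℝ≥0) : IsProbabilityMeasure (poissonPi a) := by
  unfold poissonPi; infer_instance

/-- Poisson splitting: if the blocks have independent Poisson lengths, then the numbers of coupons
of the various types in the various blocks are independent Poisson variables. -/
lemma map_blockCount_eq (hX : ∀ k, Measurable (X k)) (hindep : iIndepFun X μ)
    (hunif : ∀ k i, μ.real {ω | X k ω = i} = 1 / (n : ℝ)) (hn : n ≠ 0) [NeZero M]
    (a : Fin M → ℝ≥0) :
    (μ.prod (poissonPi fun s => n * a s)).map
      (fun q : Ω × (Fin M → ℕ) => blockCount (fun j => X j q.1) q.2) =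
    Measure.pi fun _ : Fin n => poissonPi a := by
  refine Measure.ext_of_singleton fun y => ?_
  rw [Measure.map_apply (measurable_blockCount hX) (measurableSet_singleton y)]
  -- The counts determine the block lengths, so the fibre over `y` is a product set and its measure
  -- is a multinomial weight times Poisson weights.
  let d : Fin M → ℕ := fun s => ∑ i, y i s
  have hpre : (fun q : Ω × (Fin M → ℕ) => blockCount (fun j => X j q.1) q.2) ⁻¹' {y} =
      {ω | blockCount (fun j => X j ω) d = y} ×ˢ {d} := by
    ext ⟨ω, e⟩
    simp only [Set.mem_preimage, Set.mem_singleton_iff, Set.mem_prod, Set.mem_ofPred_eq]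
    constructor
    · intro h
      have he : e = d := by
        ext s
        rw [← sum_blockCount (fun j => X j ω) e s, h]
      exact ⟨he ▸ h, he⟩
    · rintro ⟨h, rfl⟩
      exact h
  rw [hpre, Measure.prod_prod, Measure.pi_singleton, ← ENNReal.toReal_eq_toReal_iff' (by finiteness)
    (ENNReal.prod_ne_top fun i _ => measure_ne_top _ _), ENNReal.toReal_mul, ← measureReal_def,
    measureReal_blockCount_eq hX hindep hunif hn d y fun s => rfl]
  simp only [poissonPi, Measure.pi_singleton, ENNReal.toReal_prod, ← measureReal_def,
    poissonMeasure_real_singleton]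
  rw [Finset.prod_comm, ← Finset.prod_mul_distrib]
  refine Finset.prod_congr rfl fun s _ => ?_
  have hne : (n : ℝ) ≠ 0 := by exact_mod_cast hn
  have hd : ((d s)! : ℝ) ≠ 0 := by positivity
  have hp : ∏ i, ((y i s)! : ℝ) ≠ 0 := Finset.prod_ne_zero_iff.2 fun i _ => by positivity
  rw [Finset.prod_div_distrib, Finset.prod_mul_distrib, Finset.prod_pow_eq_pow_sum]
  simp only [Finset.prod_const, Finset.card_univ, Fintype.card_fin, NNReal.coe_mul,
    NNReal.coe_natCast, mul_pow, ← Real.exp_nat_mul]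
  change _ = _ * (a s : ℝ) ^ d s / _
  rw [mul_neg]
  field_simp

end Blocks

/-! ### Poisson tails, variance and sums. -/

section Poisson

lemma measureReal_poissonMeasure_Iic (a : ℝ≥0) (r : ℕ) :
    (poissonMeasure a).real (Set.Iic r) =
      ∑ j ∈ Finset.range (r + 1), Real.exp (-a) * (a : ℝ) ^ j / j ! := by
  have : (Set.Iic r : Set ℕ) = ((Finset.range (r + 1) : Finset ℕ) : Set ℕ) := by
    ext j; simp
  rw [this, ← sum_measureReal_singleton]
  exact Finset.sum_congr rfl fun j _ => poissonMeasure_real_singleton a j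

lemma poissonMeasure_zero : poissonMeasure 0 = Measure.dirac 0 := by
  refine Measure.ext_of_singleton fun j => ?_
  rw [poissonMeasure_singleton, Measure.dirac_apply' _ (measurableSet_singleton j)]
  rcases j with _ | j <;> simp

/-- The variance, from the first two factorial moments: shifting the index by one or two turns them
into multiples of the total mass. -/
lemma hasSum_poisson_sq (a : ℝ≥0) :
    HasSum (fun m : ℕ => Real.exp (-a) * (a : ℝ) ^ m / m ! * ((m : ℝ) - a) ^ 2) a := by
  have h0 := hasSum_one_poissonMeasure a
  have h1 : HasSum (fun m : ℕ => (m : ℝ) * (Real.exp (-a) * (a : ℝ) ^ m / m !)) a := by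
    rw [← hasSum_nat_add_iff' 1]
    refine (congrArg₂ (fun f v => HasSum f v) (funext fun m => ?_) ?_).mpr (h0.mul_left (a : ℝ))
    · rw [Nat.factorial_succ]
      push_cast
      field_simp
      ring
    · simp
  have h2 : HasSum (fun m : ℕ => (m : ℝ) * ((m : ℝ) - 1) * (Real.exp (-a) * (a : ℝ) ^ m / m !))
      ((a : ℝ) ^ 2) := by
    rw [← hasSum_nat_add_iff' 2]
    refine (congrArg₂ (fun f v => HasSum f v) (funext fun m => ?_) ?_).mpr
      (h0.mul_left ((a : ℝ) ^ 2))
    · rw [Nat.factorial_succ, Nat.factorial_succ]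
      push_cast
      field_simp
      ring
    · simp [Finset.sum_range_succ]
  convert (h2.add (h1.mul_left (1 - 2 * (a : ℝ)))).add (h0.mul_left ((a : ℝ) ^ 2)) using 1
  · ext m; ring
  · ring

/-- Chebyshev's inequality for the Poisson distribution. -/
lemma poissonMeasure_chebyshev (a : ℝ≥0) {c : ℝ} (hc : 0 < c) :
    (poissonMeasure a).real {m : ℕ | c ≤ |(m : ℝ) - a|} ≤ a / c ^ 2 := by
  have hint : Integrable (fun m : ℕ => ((m : ℝ) - a) ^ 2) (poissonMeasure a) := by
    rw [integrable_poissonMeasure_iff]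
    refine (hasSum_poisson_sq a).summable.congr fun m => ?_
    rw [Real.norm_of_nonneg (sq_nonneg _)]
  have hval : ∫ m : ℕ, ((m : ℝ) - a) ^ 2 ∂(poissonMeasure a) = a := by
    rw [integral_poissonMeasure]
    exact (hasSum_poisson_sq a).tsum_eq
  have h := mul_meas_ge_le_integral_of_nonneg (μ := poissonMeasure a)
    (Eventually.of_forall fun m : ℕ => sq_nonneg ((m : ℝ) - a)) hint (c ^ 2)
  rw [hval] at h
  rw [le_div_iff₀ (by positivity), mul_comm]
  refine le_trans (le_of_eq ?_) h
  congr 2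
  ext m
  simp only [Set.mem_ofPred_eq]
  rw [← sq_abs ((m : ℝ) - a)]
  exact (pow_le_pow_iff_left₀ hc.le (abs_nonneg _) two_ne_zero).symm

lemma tendsto_poissonMeasure_Iic_zero {ι : Type*} {l : Filter ι} {a : ι → ℝ≥0}
    (ha : Tendsto (fun i => (a i : ℝ)) l atTop) (r : ℕ) :
    Tendsto (fun i => (poissonMeasure (a i)).real (Set.Iic r)) l (𝓝 0) := by
  simp_rw [measureReal_poissonMeasure_Iic]
  rw [← Finset.sum_const_zero (s := Finset.range (r + 1)) (ι := ℕ)]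
  refine tendsto_finsetSum _ fun j _ => ?_
  have h := ((Real.tendsto_pow_mul_exp_neg_atTop_nhds_zero j).comp ha).div_const (j ! : ℝ)
  rw [zero_div] at h
  refine h.congr fun i => ?_
  simp [mul_comm]

variable {M : ℕ} (a : Fin M → ℝ≥0)

lemma hasLaw_sum_poissonPi (T : Finset (Fin M)) :
    HasLaw (∑ u ∈ T, fun z : Fin M → ℕ => z u) (poissonMeasure (∑ u ∈ T, a u)) (poissonPi a) := by
  have hmeas : ∀ u : Fin M, Measurable (fun z : Fin M → ℕ => z u) := fun u => measurable_pi_apply u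
  have hindep : iIndepFun (fun (u : Fin M) (z : Fin M → ℕ) => z u) (poissonPi a) :=
    iIndepFun_pi (X := fun _ => id) fun _ => aemeasurable_id
  induction T using Finset.induction_on with
  | empty =>
    refine ⟨by fun_prop, ?_⟩
    simp only [Finset.sum_empty, poissonMeasure_zero]
    change Measure.map (fun _ => 0) _ = _
    rw [Measure.map_const]
    simp
  | insert u T hu ih =>
    rw [Finset.sum_insert hu, Finset.sum_insert hu, add_comm, add_comm (a u)]
    refine IndepFun.hasLaw_add_poissonMeasure
      (hindep.indepFun_finsetSum_of_notMem hmeas hu) ih ⟨(hmeas u).aemeasurable, ?_⟩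
    exact (measurePreserving_eval (fun s => poissonMeasure (a s)) u).map_eq

lemma measureReal_partialSum_preimage (k : ℕ) (A : Set ℕ) :
    (poissonPi a).real {z | partialSum z k ∈ A} = (poissonMeasure (partialSum a k)).real A := by
  have h := hasLaw_sum_poissonPi a (Finset.univ.filter (fun u : Fin M => u.val < k))
  rw [partialSum, ← h.map_eq, map_measureReal_apply_of_aemeasurable h.aemeasurable
    (Set.to_countable _).measurableSet]
  congr 1
  ext z
  simp [partialSum]

lemma measureReal_partialSum_inter (s : Fin M) (A B : Set ℕ) :
    (poissonPi a).real {z | partialSum z s ∈ A ∧ z s ∈ B} =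
      (poissonMeasure (partialSum a s)).real A * (poissonMeasure (a s)).real B := by
  have hindep : iIndepFun (fun (u : Fin M) (z : Fin M → ℕ) => z u) (poissonPi a) :=
    iIndepFun_pi (X := fun _ => id) fun _ => aemeasurable_id
  have h := hindep.indepFun_finsetSum_of_notMem (fun u => measurable_pi_apply u)
    (s := Finset.univ.filter (fun u : Fin M => u.val < s)) (i := s) (by simp)
  have h2 := h.measure_inter_preimage_eq_mul A B (Set.to_countable _).measurableSet
    (Set.to_countable _).measurableSet
  have h3 : (poissonPi a).real ((fun z : Fin M → ℕ => z s) ⁻¹' B) =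
      (poissonMeasure (a s)).real B := by
    rw [← (measurePreserving_eval (fun s => poissonMeasure (a s)) s).map_eq,
      map_measureReal_apply (measurable_pi_apply s) (Set.to_countable _).measurableSet]
    rfl
  rw [← h3, ← measureReal_partialSum_preimage, measureReal_def, measureReal_def, measureReal_def,
    ← ENNReal.toReal_mul]
  congr 1
  convert h2 using 2
  · ext z; simp [partialSum]
  · congr 1; ext z; simp [partialSum]

end Poisson

/-! ### Increments of a sequence of times. -/

section Increments

/-- The increments of a sequence, the first one being its first value. -/
def increments {M : ℕ} (t : ℕ → ℝ≥0) (u : Fin M) : ℝ≥0 :=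
  t u - if u.val = 0 then 0 else t (u - 1)

/-- Monotonicity is needed because subtraction in `ℝ≥0` is truncated. -/
lemma partialSum_increments {M : ℕ} {t : ℕ → ℝ≥0} (ht : ∀ r, r + 1 < M → t r ≤ t (r + 1))
    {k : ℕ} (hk : k < M) : partialSum (increments t : Fin M → ℝ≥0) (k + 1) = t k := by
  have h : ∀ k (hk : k < M), partialSum (increments t : Fin M → ℝ≥0) (k + 1) =
      partialSum (increments t : Fin M → ℝ≥0) k + increments t ⟨k, hk⟩ :=
    fun k hk => partialSum_succ _ ⟨k, hk⟩
  induction k with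
  | zero => simp [h 0 hk, partialSum_zero, increments]
  | succ k ih =>
    rw [h _ hk, ih (by omega)]
    simp [increments, add_tsub_cancel_of_le (ht k hk)]

end Increments

/-! ### Asymptotic disjointness of the failures. -/

section Limit

variable {M : ℕ} {S : Finset ℕ}

lemma one_sub_poissonPi_le (a : Fin M → ℝ≥0) :
    1 - (poissonPi a).real {z | ∀ r ∈ S, r < partialSum z (r + 1)} ≤
      ∑ r ∈ S, (poissonMeasure (partialSum a (r + 1))).real (Set.Iic r) := by
  rw [← probReal_compl_eq_one_sub (Set.to_countable _).measurableSet]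
  have : {z : Fin M → ℕ | ∀ r ∈ S, r < partialSum z (r + 1)}ᶜ =
      ⋃ r ∈ S, {z | partialSum z (r + 1) ∈ Set.Iic r} := by
    ext z; simp
  rw [this]
  refine (measureReal_biUnion_finset_le _ _).trans (le_of_eq ?_)
  exact Finset.sum_congr rfl fun r _ => measureReal_partialSum_preimage a (r + 1) _

/-- Intersecting the failure at `r` with an independent jump larger than `M` in the next increment
makes the failures disjoint: after such a jump every later partial sum exceeds `M`, hence every
later threshold. There are `M + 1` increments so that index `r + 1` exists without wrapping. -/
lemma le_one_sub_poissonPi (hS : ∀ r ∈ S, r < M) (a : Fin (M + 1) → ℝ≥0) :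
    ∑ r ∈ S, (poissonMeasure (partialSum a (r + 1))).real (Set.Iic r) *
      (poissonMeasure (a (Fin.ofNat (M + 1) (r + 1)))).real (Set.Ioi M) ≤
    1 - (poissonPi a).real {z | ∀ r ∈ S, r < partialSum z (r + 1)} := by
  have hval : ∀ r ∈ S, ((Fin.ofNat (M + 1) (r + 1) : Fin (M + 1)) : ℕ) = r + 1 := by
    intro r hr
    have := hS r hr
    exact Nat.mod_eq_of_lt (by omega)
  rw [← probReal_compl_eq_one_sub (Set.to_countable _).measurableSet]
  have hterm : ∀ r ∈ S, (poissonMeasure (partialSum a (r + 1))).real (Set.Iic r) *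
      (poissonMeasure (a (Fin.ofNat (M + 1) (r + 1)))).real (Set.Ioi M) =
      (poissonPi a).real {z | partialSum z (r + 1) ∈ Set.Iic r ∧
        z (Fin.ofNat (M + 1) (r + 1)) ∈ Set.Ioi M} := by
    intro r hr
    have := measureReal_partialSum_inter a (Fin.ofNat (M + 1) (r + 1)) (Set.Iic r) (Set.Ioi M)
    rw [hval r hr] at this
    exact this.symm
  rw [Finset.sum_congr rfl hterm, ← measureReal_biUnion_finset]
  · refine measureReal_mono ?_
    intro z hz
    simp only [Set.mem_iUnion, Set.mem_ofPred_eq] at hz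
    obtain ⟨r, hr, h1, -⟩ := hz
    exact fun h => absurd (h r hr) (not_lt.2 h1)
  · have key : ∀ r ∈ S, ∀ r' ∈ S, r < r' → ∀ z : Fin (M + 1) → ℕ,
        z (Fin.ofNat (M + 1) (r + 1)) ∈ Set.Ioi M → ¬ partialSum z (r' + 1) ∈ Set.Iic r' := by
      intro r hr r' hr' hlt z h1 h2
      have h3 := partialSum_succ z (Fin.ofNat (M + 1) (r + 1))
      rw [hval r hr] at h3
      have h4 := partialSum_mono z (show r + 1 + 1 ≤ r' + 1 by omega)
      have h5 := hS r' hr'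
      simp only [Set.mem_Ioi, Set.mem_Iic] at h1 h2
      omega
    intro r hr r' hr' hne
    refine Set.disjoint_left.2 fun z h1 h2 => ?_
    rcases lt_or_gt_of_ne hne with h | h
    · exact key r hr r' hr' h z h1.2 h2.1
    · exact key r' hr' r hr h z h2.2 h1.1
  · exact fun r _ => (Set.to_countable _).measurableSet

lemma eventually_increments {t : ℕ → ℕ → ℝ≥0}
    (h : ∀ r, Tendsto (fun n => (t n (r + 1) : ℝ) - t n r) atTop atTop) (M : ℕ) :
    ∀ᶠ n in atTop, ∀ r < M, t n r ≤ t n (r + 1) ∧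
      partialSum (increments (t n) : Fin (M + 1) → ℝ≥0) (r + 1) = t n r := by
  have hmono : ∀ᶠ n in atTop, ∀ r ∈ Finset.range (M + 1), t n r ≤ t n (r + 1) := by
    rw [eventually_all_finset]
    intro r _
    filter_upwards [(h r).eventually_ge_atTop 0] with n hn
    exact_mod_cast sub_nonneg.1 hn
  filter_upwards [hmono] with n hn r hr
  exact ⟨hn r (by simp; omega),
    partialSum_increments (fun q hq => hn q (by simp; omega)) (by omega)⟩

/-- The union bound and the disjoint subevents enclose `n (1 - p)`; they agree in the limit since
the gaps between successive times diverge. Then `p ^ n = (1 - (1 - p)) ^ n` has an exponential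
limit. -/
theorem tendsto_poissonPi_pow (hS : ∀ r ∈ S, r < M) {t : ℕ → ℕ → ℝ≥0} {c : ℕ → ℝ}
    (h1 : ∀ r ∈ S, Tendsto (fun n : ℕ => n * (poissonMeasure (t n r)).real (Set.Iic r)) atTop
      (𝓝 (c r)))
    (h2 : ∀ r, Tendsto (fun n => (t n (r + 1) : ℝ) - t n r) atTop atTop) :
    Tendsto (fun n : ℕ => (poissonPi (increments (t n) : Fin (M + 1) → ℝ≥0)).real
      {z | ∀ r ∈ S, r < partialSum z (r + 1)} ^ n) atTop (𝓝 (Real.exp (-∑ r ∈ S, c r))) := by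
  have hinc := eventually_increments h2 M
  have hps : ∀ᶠ n in atTop, ∀ r ∈ S,
      partialSum (increments (t n) : Fin (M + 1) → ℝ≥0) (r + 1) = t n r := by
    filter_upwards [hinc] with n hn r hr using (hn r (hS r hr)).2
  have htail : ∀ r ∈ S, Tendsto (fun n => (poissonMeasure
      ((increments (t n) : Fin (M + 1) → ℝ≥0) (Fin.ofNat (M + 1) (r + 1)))).real (Set.Ioi M))
      atTop (𝓝 1) := by
    intro r hr
    have hval : ((Fin.ofNat (M + 1) (r + 1) : Fin (M + 1)) : ℕ) = r + 1 := by
      have := hS r hr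
      exact Nat.mod_eq_of_lt (by omega)
    have hrate : Tendsto (fun n => (((increments (t n) : Fin (M + 1) → ℝ≥0)
        (Fin.ofNat (M + 1) (r + 1)) : ℝ≥0) : ℝ)) atTop atTop := by
      refine (h2 r).congr' ?_
      filter_upwards [hinc] with n hn
      have := (hn r (hS r hr)).1
      rw [increments, hval]
      simp [NNReal.coe_sub this]
    have h := (tendsto_poissonMeasure_Iic_zero hrate M).const_sub 1
    rw [sub_zero] at h
    refine h.congr fun n => ?_
    rw [← probReal_compl_eq_one_sub measurableSet_Iic, Set.compl_Iic]
  have hlim : Tendsto (fun n : ℕ => (n : ℝ) * (1 - (poissonPi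
      (increments (t n) : Fin (M + 1) → ℝ≥0)).real {z | ∀ r ∈ S, r < partialSum z (r + 1)}))
      atTop (𝓝 (∑ r ∈ S, c r)) := by
    have hup := tendsto_finsetSum S h1
    have hlow := tendsto_finsetSum S fun r hr => (h1 r hr).mul (htail r hr)
    simp only [mul_one] at hlow
    refine tendsto_of_tendsto_of_tendsto_of_le_of_le' hlow hup ?_ ?_
    · filter_upwards [hps] with n hn
      have h := le_one_sub_poissonPi hS (increments (t n))
      refine le_trans (le_of_eq ?_) (mul_le_mul_of_nonneg_left h n.cast_nonneg)
      rw [Finset.mul_sum]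
      refine Finset.sum_congr rfl fun r hr => ?_
      rw [hn r hr, mul_assoc]
    · filter_upwards [hps] with n hn
      have h := one_sub_poissonPi_le (S := S) (increments (t n) : Fin (M + 1) → ℝ≥0)
      refine (mul_le_mul_of_nonneg_left h n.cast_nonneg).trans (le_of_eq ?_)
      rw [Finset.mul_sum]
      refine Finset.sum_congr rfl fun r hr => ?_
      rw [hn r hr]
  have h := Real.tendsto_one_add_pow_exp_of_tendsto (t := -∑ r ∈ S, c r)
    (hlim.neg.congr fun n => (mul_neg _ _).symm)
  refine h.congr fun n => ?_
  congr 1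
  ring

end Limit

/-! ### The Poisson lower tail at the critical rate. -/

section Asymptotics

lemma tendsto_rate_div (r x : ℝ) :
    Tendsto (fun L : ℝ => (L + r * Real.log L + x) / L) atTop (𝓝 1) := by
  have h1 : Tendsto (fun L : ℝ => Real.log L / L) atTop (𝓝 0) :=
    Real.isLittleO_log_id_atTop.tendsto_div_nhds_zero
  have h2 : Tendsto (fun L : ℝ => x / L) atTop (𝓝 0) := tendsto_const_nhds.div_atTop tendsto_id
  have h := ((tendsto_const_nhds (x := (1 : ℝ))).add (h1.const_mul r)).add h2
  simp only [mul_zero, add_zero] at h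
  refine h.congr' ?_
  filter_upwards [eventually_gt_atTop 0] with L hL
  field_simp

lemma tendsto_rate (r x : ℝ) :
    Tendsto (fun L : ℝ => L + r * Real.log L + x) atTop atTop := by
  have h := (tendsto_rate_div r x).pos_mul_atTop one_pos tendsto_id
  refine h.congr' ?_
  filter_upwards [eventually_gt_atTop 0] with L hL
  simp only [id]
  field_simp

/-- Here `L` plays `ln n`. With rate `τ = L + r ln L + x`, the `j`-th term is `e^{-x} (τ/L)^j
L^{j-r} / j!`, so only `j = r` survives. -/
lemma tendsto_exp_mul_poissonMeasure_Iic (r : ℕ) (x : ℝ) :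
    Tendsto (fun L : ℝ => Real.exp L *
      (poissonMeasure (Real.toNNReal (L + r * Real.log L + x))).real (Set.Iic r)) atTop
      (𝓝 (Real.exp (-x) / r !)) := by
  simp_rw [measureReal_poissonMeasure_Iic, Finset.mul_sum]
  have hlim : (Real.exp (-x) / r ! : ℝ) =
      ∑ j ∈ Finset.range (r + 1), if j = r then Real.exp (-x) / r ! else 0 := by
    simp
  rw [hlim]
  refine tendsto_finsetSum _ fun j hj => ?_
  have hjr : j ≤ r := Nat.lt_succ_iff.1 (Finset.mem_range.1 hj)
  have h1 := (tendsto_rate_div r x).pow j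
  have h2 : Tendsto (fun L : ℝ => L ^ j / L ^ r) atTop (𝓝 (if j = r then 1 else 0)) := by
    split_ifs with h
    · subst h
      refine tendsto_const_nhds.congr' ?_
      filter_upwards [eventually_gt_atTop 0] with L hL
      field_simp
    · exact tendsto_pow_div_pow_atTop_zero (lt_of_le_of_ne hjr h)
  have h3 := (h1.mul h2).const_mul (Real.exp (-x) / j !)
  have he : Real.exp (-x) / j ! * (1 ^ j * if j = r then (1 : ℝ) else 0) =
      if j = r then Real.exp (-x) / r ! else 0 := by
    split_ifs with h <;> simp [h]
  rw [he] at h3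
  refine h3.congr' ?_
  filter_upwards [eventually_gt_atTop 0, (tendsto_rate r x).eventually_ge_atTop 0] with L hL hτ
  rw [Real.coe_toNNReal _ hτ]
  have hexp : Real.exp (-(L + r * Real.log L + x)) = Real.exp (-L) * (L ^ r)⁻¹ * Real.exp (-x) := by
    rw [neg_add, neg_add, Real.exp_add, Real.exp_add, Real.exp_neg (r * Real.log L),
      Real.exp_nat_mul, Real.exp_log hL]
  rw [hexp, Real.exp_neg L, div_pow]
  have := Real.exp_ne_zero L
  field_simp

end Asymptotics

/-! ### Comparing fixed and Poisson observation times. -/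

section Poissonization

variable {Ω : Type*} {n M : ℕ}

/-- The event that every type has arrived more than `r` times among the first `k r` coupons, for
all `r ∈ S`. -/
def collectedEvent (X : ℕ → Ω → Fin n) (S : Finset ℕ) (k : ℕ → ℕ) : Set Ω :=
  {ω | ∀ r ∈ S, ∀ i, r < couponCount (fun j => X j ω) (k r) i}

lemma collectedEvent_mono {X : ℕ → Ω → Fin n} {S : Finset ℕ} {k k' : ℕ → ℕ} (h : ∀ r ∈ S, k r ≤ k' r) :
    collectedEvent X S k ⊆ collectedEvent X S k' := fun _ hω r hr i =>
  (hω r hr i).trans_le (couponCount_mono _ i (h r hr))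

variable [MeasurableSpace Ω] {μ : Measure Ω} [IsProbabilityMeasure μ] {X : ℕ → Ω → Fin n}
  {S : Finset ℕ}

lemma measureReal_poissonized (hX : ∀ k, Measurable (X k)) (hindep : iIndepFun X μ)
    (hunif : ∀ k i, μ.real {ω | X k ω = i} = 1 / (n : ℝ)) (hn : n ≠ 0) [NeZero M]
    (a : Fin M → ℝ≥0) :
    (μ.prod (poissonPi fun s => n * a s)).real
      {q | q.1 ∈ collectedEvent X S (fun r => partialSum q.2 (r + 1))} =
    (poissonPi a).real {z | ∀ r ∈ S, r < partialSum z (r + 1)} ^ n := by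
  have h : (Measure.pi fun _ : Fin n => poissonPi a).real
      (Set.univ.pi fun _ => {z | ∀ r ∈ S, r < partialSum z (r + 1)}) =
      (poissonPi a).real {z | ∀ r ∈ S, r < partialSum z (r + 1)} ^ n := by
    simp [measureReal_def, Measure.pi_pi]
  rw [← h, ← map_blockCount_eq hX hindep hunif hn a,
    map_measureReal_apply (measurable_blockCount hX) (Set.to_countable _).measurableSet]
  congr 1
  ext q
  simp only [collectedEvent, Set.mem_ofPred_eq, Set.mem_preimage, Set.mem_univ_pi,
    partialSum_blockCount]
  exact ⟨fun h i r hr => h r hr i, fun h r hr i => h i r hr⟩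

lemma poissonPi_exists_le (a : Fin M → ℝ≥0) (A : ℕ → Set ℕ) :
    (poissonPi a).real {d | ∃ r ∈ S, partialSum d (r + 1) ∈ A r} ≤
      ∑ r ∈ S, (poissonMeasure (partialSum a (r + 1))).real (A r) := by
  have : {d : Fin M → ℕ | ∃ r ∈ S, partialSum d (r + 1) ∈ A r} =
      ⋃ r ∈ S, {d | partialSum d (r + 1) ∈ A r} := by
    ext d; simp
  rw [this]
  refine (measureReal_biUnion_finset_le _ _).trans (le_of_eq ?_)
  exact Finset.sum_congr rfl fun r _ => measureReal_partialSum_preimage a (r + 1) _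

/-- The event is increasing in the observation times, so success at the Poisson times forces success
at the times `k r` unless some Poisson time exceeds its `k r`. -/
lemma poissonPi_pow_le (hX : ∀ k, Measurable (X k)) (hindep : iIndepFun X μ)
    (hunif : ∀ k i, μ.real {ω | X k ω = i} = 1 / (n : ℝ)) (hn : n ≠ 0) [NeZero M]
    (a : Fin M → ℝ≥0) (k : ℕ → ℕ) :
    (poissonPi a).real {z | ∀ r ∈ S, r < partialSum z (r + 1)} ^ n ≤
      μ.real (collectedEvent X S k) +
        ∑ r ∈ S, (poissonMeasure (n * partialSum a (r + 1))).real (Set.Ioi (k r)) := by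
  have hps : ∀ r, partialSum (fun s => n * a s) (r + 1) = n * partialSum a (r + 1) :=
    fun r => (Finset.mul_sum _ _ _).symm
  rw [← measureReal_poissonized hX hindep hunif hn a]
  have hsub : {q : Ω × (Fin M → ℕ) |
      q.1 ∈ collectedEvent X S (fun r => partialSum q.2 (r + 1))} ⊆
      collectedEvent X S k ×ˢ Set.univ ∪
        Set.univ ×ˢ {d | ∃ r ∈ S, partialSum d (r + 1) ∈ Set.Ioi (k r)} := by
    rintro ⟨ω, d⟩ hq
    by_cases h : ∃ r ∈ S, partialSum d (r + 1) ∈ Set.Ioi (k r)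
    · exact Or.inr ⟨trivial, h⟩
    · push Not at h
      exact Or.inl ⟨collectedEvent_mono (fun r hr => not_lt.1 (h r hr)) hq, trivial⟩
  refine (measureReal_mono hsub).trans ((measureReal_union_le _ _).trans ?_)
  rw [measureReal_prod_prod, measureReal_prod_prod, probReal_univ, probReal_univ, mul_one, one_mul]
  simp_rw [← hps]
  gcongr
  exact poissonPi_exists_le (fun s => n * a s) (fun r => Set.Ioi (k r))

lemma le_poissonPi_pow (hX : ∀ k, Measurable (X k)) (hindep : iIndepFun X μ)
    (hunif : ∀ k i, μ.real {ω | X k ω = i} = 1 / (n : ℝ)) (hn : n ≠ 0) [NeZero M]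
    (a : Fin M → ℝ≥0) (k : ℕ → ℕ) :
    μ.real (collectedEvent X S k) ≤
      (poissonPi a).real {z | ∀ r ∈ S, r < partialSum z (r + 1)} ^ n +
        ∑ r ∈ S, (poissonMeasure (n * partialSum a (r + 1))).real (Set.Iio (k r)) := by
  have hps : ∀ r, partialSum (fun s => n * a s) (r + 1) = n * partialSum a (r + 1) :=
    fun r => (Finset.mul_sum _ _ _).symm
  rw [← measureReal_poissonized hX hindep hunif hn a]
  have hsub : collectedEvent X S k ×ˢ Set.univ ⊆ {q : Ω × (Fin M → ℕ) |
      q.1 ∈ collectedEvent X S (fun r => partialSum q.2 (r + 1))} ∪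
        Set.univ ×ˢ {d | ∃ r ∈ S, partialSum d (r + 1) ∈ Set.Iio (k r)} := by
    rintro ⟨ω, d⟩ hq
    by_cases h : ∃ r ∈ S, partialSum d (r + 1) ∈ Set.Iio (k r)
    · exact Or.inr ⟨trivial, h⟩
    · push Not at h
      exact Or.inl (collectedEvent_mono (fun r hr => not_lt.1 (h r hr)) hq.1)
  have h1 : μ.real (collectedEvent X S k) =
      (μ.prod (poissonPi fun s => n * a s)).real (collectedEvent X S k ×ˢ Set.univ) := by
    rw [measureReal_prod_prod, probReal_univ, mul_one]
  rw [h1]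
  refine (measureReal_mono hsub).trans ((measureReal_union_le _ _).trans ?_)
  rw [measureReal_prod_prod, probReal_univ, one_mul]
  simp_rw [← hps]
  gcongr
  exact poissonPi_exists_le (fun s => n * a s) (fun r => Set.Iio (k r))

end Poissonization

/-! ### Asymptotics along integer `n`. -/

section Rates

/-- The centring `ln n + r ln ln n + x`. -/
noncomputable def rate (x : ℝ) (n r : ℕ) : ℝ :=
  Real.log n + r * Real.log (Real.log n) + x

lemma tendsto_log_natCast : Tendsto (fun n : ℕ => Real.log n) atTop atTop :=
  Real.tendsto_log_atTop.comp tendsto_natCast_atTop_atTop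

lemma tendsto_rate_atTop (x : ℝ) (r : ℕ) : Tendsto (fun n => rate x n r) atTop atTop :=
  (tendsto_rate r x).comp tendsto_log_natCast

lemma tendsto_rate_div_natCast (x : ℝ) (r : ℕ) :
    Tendsto (fun n : ℕ => rate x n r / n) atTop (𝓝 0) := by
  have h1 := (tendsto_rate_div r x).comp tendsto_log_natCast
  have h2 : Tendsto (fun n : ℕ => Real.log n / n) atTop (𝓝 0) :=
    (Real.isLittleO_log_id_atTop.tendsto_div_nhds_zero).comp tendsto_natCast_atTop_atTop
  have h3 := h1.mul h2
  rw [mul_zero] at h3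
  refine h3.congr' ?_
  filter_upwards [tendsto_log_natCast.eventually_gt_atTop 0] with n hn
  simp only [Function.comp, rate]
  field_simp

lemma tendsto_mul_poissonMeasure_rate (x : ℝ) (r : ℕ) :
    Tendsto (fun n : ℕ => n * (poissonMeasure (Real.toNNReal (rate x n r))).real (Set.Iic r)) atTop
      (𝓝 (Real.exp (-x) / r !)) := by
  refine ((tendsto_exp_mul_poissonMeasure_Iic r x).comp tendsto_log_natCast).congr' ?_
  filter_upwards [eventually_gt_atTop 0] with n hn
  simp only [Function.comp, rate]
  rw [Real.exp_log (by exact_mod_cast hn)]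

lemma tendsto_rate_sub (x : ℕ → ℝ) (r : ℕ) :
    Tendsto (fun n => (Real.toNNReal (rate (x (r + 1)) n (r + 1)) : ℝ) -
      Real.toNNReal (rate (x r) n r)) atTop atTop := by
  have h : Tendsto (fun n : ℕ => Real.log (Real.log n) + (x (r + 1) - x r)) atTop atTop :=
    tendsto_atTop_add_const_right _ _ (Real.tendsto_log_atTop.comp tendsto_log_natCast)
  refine h.congr' ?_
  filter_upwards [(tendsto_rate_atTop (x (r + 1)) (r + 1)).eventually_ge_atTop 0,
    (tendsto_rate_atTop (x r) r).eventually_ge_atTop 0] with n h1 h2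
  rw [Real.coe_toNNReal _ h1, Real.coe_toNNReal _ h2, rate, rate]
  push_cast
  ring

lemma tendsto_poissonMeasure_deviation (x : ℝ) (r : ℕ) {ε : ℝ} (hε : 0 < ε) :
    Tendsto (fun n : ℕ => (poissonMeasure (n * Real.toNNReal (rate x n r))).real
      {m : ℕ | n * ε ≤ |(m : ℝ) - n * rate x n r|}) atTop (𝓝 0) := by
  have h := (tendsto_rate_div_natCast x r).div_const (ε ^ 2)
  rw [zero_div] at h
  refine squeeze_zero' (Eventually.of_forall fun n => measureReal_nonneg) ?_ h
  filter_upwards [eventually_gt_atTop 0, (tendsto_rate_atTop x r).eventually_ge_atTop 0]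
    with n hn hr
  have hn' : (0 : ℝ) < n := by exact_mod_cast hn
  have hc := poissonMeasure_chebyshev (n * Real.toNNReal (rate x n r))
    (mul_pos hn' hε)
  simp only [NNReal.coe_mul, NNReal.coe_natCast, Real.coe_toNNReal _ hr] at hc
  refine hc.trans (le_of_eq ?_)
  field_simp

end Rates

/-! ### De-Poissonization and joint distribution functions. -/

section FiniteDimensional

variable {Ω : ℕ+ → Type*} [∀ n, MeasurableSpace (Ω n)]
  {μ : (n : ℕ+) → Measure (Ω n)} [∀ n, IsProbabilityMeasure (μ n)]
  {X : (n : ℕ+) → ℕ → Ω n → Fin (n : ℕ)}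

lemma tendsto_measureReal_collectedEvent (hX : ∀ n k, Measurable (X n k))
    (hindep : ∀ n, iIndepFun (X n) (μ n))
    (hunif : ∀ n k i, (μ n).real {ω | X n k ω = i} = 1 / (n : ℝ)) (S : Finset ℕ) (x : ℕ → ℝ) :
    Tendsto (fun n : ℕ+ => (μ n).real (collectedEvent (X n) S
      (fun r => ⌊((n : ℕ) : ℝ) * rate (x r) n r⌋₊))) atTop
      (𝓝 (Real.exp (-∑ r ∈ S, Real.exp (-x r) / r !))) := by
  let M := S.sup id + 1
  have hS : ∀ r ∈ S, r < M := fun r hr => Nat.lt_succ_of_le (Finset.le_sup (f := id) hr)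
  let t : ℝ → ℕ → ℕ → ℝ≥0 := fun ε n r => Real.toNNReal (rate (x r + ε) n r)
  let g : ℝ → ℕ → ℝ := fun ε n => (poissonPi (increments (t ε n) : Fin (M + 1) → ℝ≥0)).real
    {z | ∀ r ∈ S, r < partialSum z (r + 1)} ^ n
  let G : ℝ → ℝ := fun ε => Real.exp (-∑ r ∈ S, Real.exp (-(x r + ε)) / r !)
  let e : ℝ → ℕ → ℝ := fun ε n => ∑ r ∈ S, (poissonMeasure (n * t ε n r)).real
    {m : ℕ | n * |ε| ≤ |(m : ℝ) - n * rate (x r + ε) n r|}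
  have hg : ∀ ε, Tendsto (g ε) atTop (𝓝 (G ε)) := fun ε =>
    tendsto_poissonPi_pow hS (fun r _ => tendsto_mul_poissonMeasure_rate (x r + ε) r)
      (tendsto_rate_sub fun r => x r + ε)
  have he : ∀ ε ≠ 0, Tendsto (e ε) atTop (𝓝 0) := by
    intro ε hε
    rw [← Finset.sum_const_zero (s := S) (ι := ℕ)]
    exact tendsto_finsetSum _ fun r _ =>
      tendsto_poissonMeasure_deviation (x r + ε) r (abs_pos.2 hε)
  have hinc : ∀ ε, ∀ᶠ n in atTop, ∀ r ∈ S,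
      partialSum (increments (t ε n) : Fin (M + 1) → ℝ≥0) (r + 1) = t ε n r := fun ε => by
    filter_upwards [eventually_increments (t := t ε) (tendsto_rate_sub fun r => x r + ε) M] with n hn r hr
      using (hn r (hS r hr)).2
  have hG : Continuous G := by fun_prop
  have hG0 : G 0 = Real.exp (-∑ r ∈ S, Real.exp (-x r) / r !) := by simp [G]
  rw [← hG0]
  refine tendsto_order.2 ⟨fun b hb => ?_, fun b hb => ?_⟩
  -- Lower bound: a negative shift keeps the Poisson times below the fixed ones with high
  -- probability. The upper bound uses a positive shift.
  · obtain ⟨ε, hεb, hε⟩ : ∃ ε, b < G ε ∧ ε < 0 :=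
      (((hG.tendsto 0).eventually_const_lt hb).filter_mono nhdsWithin_le_nhds |>.and
        (self_mem_nhdsWithin : Set.Iio (0 : ℝ) ∈ 𝓝[<] 0)).exists
    have hlim := (hg ε).sub (he ε hε.ne)
    rw [sub_zero] at hlim
    filter_upwards [tendsto_PNat_val_atTop_atTop.eventually (hlim.eventually_const_lt hεb),
      tendsto_PNat_val_atTop_atTop.eventually (hinc ε)] with n hn hps
    refine hn.trans_le ?_
    have h := poissonPi_pow_le (S := S) (hX n) (hindep n) (hunif n) n.ne_zero
      (increments (t ε n) : Fin (M + 1) → ℝ≥0) (fun r => ⌊((n : ℕ) : ℝ) * rate (x r) n r⌋₊)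
    rw [sub_le_iff_le_add]
    refine h.trans (add_le_add_right (Finset.sum_le_sum fun r hr => ?_) _)
    rw [hps r hr]
    refine measureReal_mono fun m hm => ?_
    -- This form of the floor inequality needs `m ≠ 0` in place of a nonnegative rate.
    have h1 := (Nat.floor_lt' (by simp at hm; omega)).1 (Set.mem_Ioi.1 hm)
    have h2 : rate (x r + ε) n r = rate (x r) n r + ε := by simp only [rate]; ring
    simp only [Set.mem_ofPred_eq, abs_of_neg hε, h2]
    refine le_trans ?_ (le_abs_self _)
    nlinarith
  · obtain ⟨ε, hεb, hε⟩ : ∃ ε, G ε < b ∧ 0 < ε :=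
      (((hG.tendsto 0).eventually_lt_const hb).filter_mono nhdsWithin_le_nhds |>.and
        (self_mem_nhdsWithin : Set.Ioi (0 : ℝ) ∈ 𝓝[>] 0)).exists
    have hlim := (hg ε).add (he ε hε.ne')
    rw [add_zero] at hlim
    filter_upwards [tendsto_PNat_val_atTop_atTop.eventually (hlim.eventually_lt_const hεb),
      tendsto_PNat_val_atTop_atTop.eventually (hinc ε)] with n hn hps
    refine lt_of_le_of_lt ?_ hn
    have h := le_poissonPi_pow (S := S) (hX n) (hindep n) (hunif n) n.ne_zero
      (increments (t ε n) : Fin (M + 1) → ℝ≥0) (fun r => ⌊((n : ℕ) : ℝ) * rate (x r) n r⌋₊)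
    refine h.trans (add_le_add_right (Finset.sum_le_sum fun r hr => ?_) _)
    rw [hps r hr]
    refine measureReal_mono fun m hm => ?_
    have h1 := Nat.lt_of_lt_floor (Set.mem_Iio.1 hm)
    have h2 : rate (x r + ε) n r = rate (x r) n r + ε := by simp only [rate]; ring
    simp only [Set.mem_ofPred_eq, abs_of_pos hε, h2]
    refine le_trans ?_ (neg_le_abs _)
    nlinarith

lemma tendsto_measureReal_normalizedTimes (hX : ∀ n k, Measurable (X n k))
    (hindep : ∀ n, iIndepFun (X n) (μ n))
    (hunif : ∀ n k i, (μ n).real {ω | X n k ω = i} = 1 / (n : ℝ)) (S : Finset ℕ) (x : ℕ → ℝ) :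
    Tendsto (fun n : ℕ+ => (μ n).real
      {ω | ∀ r ∈ S, normalizedTimes (fun j => X n j ω) r ≤ x r}) atTop
      (𝓝 (Real.exp (-∑ r ∈ S, Real.exp (-x r) / r !))) := by
  refine (tendsto_measureReal_collectedEvent hX hindep hunif S x).congr' ?_
  have hpos : ∀ᶠ n : ℕ in atTop, ∀ r ∈ S, 0 ≤ rate (x r) n r := by
    rw [eventually_all_finset]
    exact fun r _ => (tendsto_rate_atTop (x r) r).eventually_ge_atTop 0
  filter_upwards [tendsto_PNat_val_atTop_atTop.eventually hpos] with n hn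
  refine measureReal_congr ?_
  -- Almost sure completion excludes the junk value, so the two events agree up to a null set.
  filter_upwards [ae_exists_album_eq_univ (hX n) (hindep n) (hunif n)] with ω hω
  have hn0 : (0 : ℝ) < (n : ℕ) := by exact_mod_cast n.pos
  refine propext (forall₂_congr fun r hr => ?_)
  rw [← completionTime_le_iff (hω r), Nat.le_floor_iff (mul_nonneg hn0.le (hn r hr)), mul_comm,
    ← div_le_iff₀ hn0, normalizedTimes, rate, sub_le_iff_le_add, sub_le_iff_le_add]
  constructor <;> intro h <;> linarith

end FiniteDimensional

/-! ### The limiting Gumbel law. -/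

section Gumbel

variable {Ω' : Type*} [MeasurableSpace Ω'] {P : Measure Ω'} [IsProbabilityMeasure P]

/-- Approaching `x` from the right, continuity of `F` rules out an atom, so strict and weak
inequalities have the same probability. -/
lemma measureReal_le_eq_of_continuous {Z : Ω' → ℝ} {F : ℝ → ℝ} (hF : Continuous F)
    (h : ∀ x, P.real {ω | Z ω < x} = F x) (x : ℝ) : P.real {ω | Z ω ≤ x} = F x := by
  refine le_antisymm ?_ ?_
  · refine ge_of_tendsto ((hF.tendsto x).mono_left (nhdsWithin_le_nhds (s := Set.Ioi x))) ?_
    filter_upwards [self_mem_nhdsWithin] with y hy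
    rw [← h y]
    exact measureReal_mono fun ω (hω : Z ω ≤ x) => show Z ω < y from hω.trans_lt hy
  · rw [← h x]
    exact measureReal_mono fun ω (hω : Z ω < x) => show Z ω ≤ x from hω.le

lemma measureReal_forall_le_gumbel {B : ℕ → Ω' → ℝ} (hB_indep : iIndepFun B P)
    (hB_gumbel : ∀ (r : ℕ) (x : ℝ),
      P.real {ω | B r ω < x} = Real.exp (-(Real.exp (-x) / (r ! : ℝ)))) (S : Finset ℕ)
    (x : ℕ → ℝ) :
    P.real {ω | ∀ r ∈ S, B r ω ≤ x r} = Real.exp (-∑ r ∈ S, Real.exp (-x r) / r !) := by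
  have h := hB_indep.measure_inter_preimage_eq_mul S (sets := fun r => Set.Iic (x r))
    fun r _ => measurableSet_Iic
  have hset : {ω | ∀ r ∈ S, B r ω ≤ x r} = ⋂ r ∈ S, B r ⁻¹' Set.Iic (x r) := by
    ext ω; simp
  rw [hset, measureReal_def, h, ENNReal.toReal_prod, ← Finset.sum_neg_distrib, Real.exp_sum]
  refine Finset.prod_congr rfl fun r _ => ?_
  exact measureReal_le_eq_of_continuous (F := fun x => Real.exp (-(Real.exp (-x) / r !)))
    (by fun_prop) (hB_gumbel r) (x r)

end Gumbel

end CouponCollector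

theorem theorem3
    -- for every number `n ≥ 1` of types: independent, uniformly distributed coupons
    {Ω : ℕ+ → Type*} [∀ n, MeasurableSpace (Ω n)]
    (μ : (n : ℕ+) → Measure (Ω n)) [∀ n, IsProbabilityMeasure (μ n)]
    (X : (n : ℕ+) → ℕ → Ω n → Fin (n : ℕ))
    (hX_meas : ∀ n k, Measurable (X n k))
    (hX_indep : ∀ n, iIndepFun (X n) (μ n))
    (hX_unif : ∀ n k i, (μ n).real {ω | X n k ω = i} = 1 / (n : ℝ))
    -- the limit: independent Gumbel variables
    {Ω' : Type*} [MeasurableSpace Ω'] (P : Measure Ω') [IsProbabilityMeasure P]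
    (B : ℕ → Ω' → ℝ)
    (hB_meas : ∀ r, Measurable (B r))
    (hB_indep : iIndepFun B P)
    (hB_gumbel : ∀ (r : ℕ) (x : ℝ),
      P.real {ω | B r ω < x} = Real.exp (-(Real.exp (-x) / (r ! : ℝ)))) :
    -- almost surely all albums are completed in finite time
    (∀ n, ∀ᵐ ω ∂(μ n), ∀ r : ℕ, ∃ k : ℕ,
      CouponCollector.album (fun j => X n j ω) k r = Set.univ) ∧
    -- convergence in distribution in the product space `ℕ → ℝ`
    TendstoInDistribution
      (fun (n : ℕ+) (ω : Ω n) => CouponCollector.normalizedTimes (fun j => X n j ω))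
      atTop (fun (ω : Ω') (r : ℕ) => B r ω) μ P := by
  have hmeas := fun n => CouponCollector.measurable_normalizedTimes (hX_meas n)
  have hlim : Measurable (fun (ω : Ω') (r : ℕ) => B r ω) := measurable_pi_lambda _ hB_meas
  refine ⟨fun n => CouponCollector.ae_exists_album_eq_univ (hX_meas n) (hX_indep n) (hX_unif n),
    ⟨fun n => (hmeas n).aemeasurable, hlim.aemeasurable, ?_⟩⟩
  refine CouponCollector.tendsto_probabilityMeasure_of_tendsto_cdf fun S b => ?_
  have hset := CouponCollector.measurableSet_forall_mem_le S b
  simp only [ProbabilityMeasure.coe_mk]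
  rw [map_measureReal_apply hlim hset]
  simp_rw [map_measureReal_apply (hmeas _) hset]
  have h := CouponCollector.tendsto_measureReal_normalizedTimes hX_meas hX_indep hX_unif S b
  rw [← CouponCollector.measureReal_forall_le_gumbel hB_indep hB_gumbel S b] at h
  exact h
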